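/- Let $\ell\ge 1$ be an integer, let $q$ be a complex number with $0<|q|<1$, and let $a,x_1,\dots,x_\ell$ be elements of a field $K\supseteq\mathbb C$ (for instance $K=\mathbb C$, or $K=\mathbb C(a,x_1,\dots,x_\ell)$ with $a,x_1,\dots,x_\ell$ indeterminates). For $\alpha\in K$ and an integer $n\ge 0$ put $$(\alpha)_n=\prod_{k=0}^{n-1}(1-\alpha q^k),\qquad (\alpha)_{-n}=\prod_{k=1}^{n}(1-\alpha q^{-k})^{-1},$$ so that, for $\alpha\in\mathbb C$, $(\alpha)_n=(\alpha)_\infty/(\alpha q^n)_\infty$ with $(\alpha)_\infty=\prod_{k\ge0}(1-\alpha q^k)$, whenever $(\alpha q^n)_\infty\ne0$. For vectors $i,j\in\mathbb Z_{\ge0}^\ell$ write $|i|=i_1+\cdots+i_\ell$, and write $j\le i$ if $j_k\le i_k$ for all $k$. For $j\le i$ define $$M(i;j;A_\ell)=\prod_{r,s=1}^{\ell}\Bigl(q\tfrac{x_r}{x_s}q^{j_r-j_s}\Bigr)_{i_r-j_r}^{-1}\ \prod_{k=1}^{\ell}\Bigl(aq\tfrac{x_k}{x_\ell}\Bigr)_{i_k+|j|}^{-1},$$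 $$M^*(i;j;A_\ell)=\prod_{k=1}^{\ell}\Bigl[1-a\tfrac{x_k}{x_\ell}q^{i_k+|i|}\Bigr]\prod_{k=1}^{\ell}\Bigl(aq\tfrac{x_k}{x_\ell}\Bigr)_{j_k+|i|-1}\prod_{r,s=1}^{\ell}\Bigl(q\tfrac{x_r}{x_s}q^{j_r-j_s}\Bigr)_{i_r-j_r}^{-1}(-1)^{|i|-|j|}q^{\binom{|i|-|j|}{2}},$$ $$M(i;j;C_\ell)=\prod_{r,s=1}^{\ell}\Bigl[\Bigl(q\tfrac{x_r}{x_s}q^{j_r-j_s}\Bigr)_{i_r-j_r}^{-1}\bigl(qx_rx_sq^{j_r+j_s}\bigr)_{i_r-j_r}^{-1}\Bigr],$$ $$M^*(i;j;C_\ell)=\prod_{r,s=1}^{\ell}\Bigl[\Bigl(q\tfrac{x_r}{x_s}q^{j_r-j_s}\Bigr)_{i_r-j_r}^{-1}\bigl(x_rx_sq^{j_r+i_s}\bigr)_{i_r-j_r}^{-1}\Bigr]\prod_{1\le r<s\le\ell}\frac{1-x_rx_sq^{j_r+j_s}}{1-x_rx_sq^{i_r+i_s}}\,(-1)^{|i|-|j|}q^{\binom{|i|-|j|}{2}}.$$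 Let $G=A_\ell$ or $G=C_\ell$, and suppose that all $x_k\neq 0$ and that none of the denominators in $M(i;j;G)$ and $M^*(i;j;G)$, $j\le i$, vanishes (for $G=A_\ell$ this includes $1-ax_k/x_\ell\ne0$ for all $k$, the denominator of $(aqx_k/x_\ell)_{-1}$). Let $A=(A_N)$ and $B=(B_N)$ be families of elements of $K$ indexed by $N\in\mathbb Z_{\ge0}^\ell$. Then $A$ and $B$ form a $G$-Bailey pair, i.e. $$B_N=\sum_{0\le y\le N}M(N;y;G)\,A_y\qquad\text{for all }N\in\mathbb Z_{\ge0}^\ell,$$ if and only if $$A_N=\sum_{0\le y\le N}M^*(N;y;G)\,B_y\qquad\text{for all }N\in\mathbb Z_{\ge0}^\ell.$$ -/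

import Mathlib

/-- The infinite `q`-shifted factorial `(α; q)_∞ = ∏_{k ≥ 0} (1 - α q^k)` of complex numbers. -/
noncomputable def qPochInf (q α : ℂ) : ℂ := ∏' k : ℕ, (1 - α * q ^ k)

/-- The `q`-shifted factorial `(α; q)_n` for an integer `n`, in an arbitrary field:
`(α; q)_n = ∏_{k=0}^{n-1} (1 - α q^k)` for `n ≥ 0`, and
`(α; q)_{-n} = 1 / ∏_{k=1}^{n} (1 - α q^{-k})` for `n > 0`.
Over `ℂ` this is `(α; q)_∞ / (α q^n; q)_∞`, see `qPoch_eq_div`. -/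
def qPoch {K : Type*} [Field K] (q α : K) : ℤ → K
  | Int.ofNat n => ∏ k ∈ Finset.range n, (1 - α * q ^ k)
  | Int.negSucc n => (∏ k ∈ Finset.range (n + 1), (1 - α * (q ^ (k + 1))⁻¹))⁻¹

theorem qPochInf_eq_prod_mul {q : ℂ} (hq : ‖q‖ < 1) (α : ℂ) (n : ℕ) :
    qPochInf q α = (∏ k ∈ Finset.range n, (1 - α * q ^ k)) * qPochInf q (α * q ^ n) := by
  have key : ∀ β : ℂ, Multipliable fun k : ℕ => (1 - β * q ^ k) := by
    intro β
    have h : Summable fun k : ℕ => ‖-(β * q ^ k)‖ := by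
      simp only [norm_neg, norm_mul, norm_pow]
      exact (summable_geometric_of_lt_one (norm_nonneg _) hq).mul_left _
    simpa [sub_eq_add_neg] using multipliable_one_add_of_summable h
  induction n with
  | zero => simp
  | succ n ih =>
    have h1 : qPochInf q (α * q ^ n)
        = (1 - α * q ^ n) * qPochInf q (α * q ^ (n + 1)) := by
      have h2 : (fun k : ℕ => 1 - α * q ^ n * q ^ (k + 1))
          = fun k : ℕ => 1 - α * q ^ (n + 1) * q ^ k := by
        funext k; ring
      unfold qPochInf
      rw [_root_.tprod_eq_zero_mul' (by rw [h2]; exact key _), h2]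
      simp
    rw [ih, h1, Finset.prod_range_succ, mul_assoc]

/-- The finite products of `qPoch` agree with the quotient of infinite products. -/
theorem qPoch_eq_div {q : ℂ} (hq0 : q ≠ 0) (hq : ‖q‖ < 1) (α : ℂ) (n : ℤ)
    (h : qPochInf q (α * q ^ n) ≠ 0) :
    qPoch q α n = qPochInf q α / qPochInf q (α * q ^ n) := by
  cases n with
  | ofNat n =>
    rw [eq_div_iff h, qPochInf_eq_prod_mul hq α n]
    simp [qPoch]
  | negSucc n =>
    have e := qPochInf_eq_prod_mul hq (α * q ^ (Int.negSucc n)) (n + 1)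
    have e2 : α * q ^ (Int.negSucc n) * q ^ (n + 1) = α := by
      rw [zpow_negSucc, mul_assoc, inv_mul_cancel₀ (pow_ne_zero _ hq0), mul_one]
    have e3 : ∏ k ∈ Finset.range (n + 1), (1 - α * q ^ (Int.negSucc n) * q ^ k)
        = ∏ k ∈ Finset.range (n + 1), (1 - α * (q ^ (k + 1))⁻¹) := by
      rw [← Finset.prod_range_reflect]
      refine Finset.prod_congr rfl fun k hk => ?_
      have hk' : k ≤ n := by simpa [Nat.lt_succ_iff] using hk
      have : q ^ (n + 1) = q ^ (k + 1) * q ^ (n - k) := by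
        rw [← pow_add]; congr 1; omega
      have h4 : n + 1 - 1 - k = n - k := by omega
      rw [zpow_negSucc, h4, this]
      field_simp
    rw [e2, e3] at e
    have hα : qPochInf q α ≠ 0 := fun h0 => h (by rw [e, h0, mul_zero])
    rw [e, qPoch]
    field_simp

/-- The two families of root systems. -/
inductive RootFamily
  | A
  | C

section BaileyDefs

variable {K : Type*} [Field K] {m : ℕ}

/-- `i_1 + ⋯ + i_ℓ`, as an integer. -/
def vecSum (i : Fin m → ℕ) : ℤ := ∑ k, (i k : ℤ)

/-- The sign and power `(-1)^d q^{d choose 2}`. -/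
def signPow (q : K) (d : ℤ) : K := (-1) ^ d * q ^ (d * (d - 1) / 2)

/-- The factor `(q (x_r / x_s) q^{j_r - j_s}; q)_{i_r - j_r}`. -/
def ratioPoch (q : K) (x : Fin m → K) (i j : Fin m → ℕ) (r s : Fin m) : K :=
  qPoch q (q * (x r / x s) * q ^ ((j r : ℤ) - j s)) ((i r : ℤ) - j r)

/-- The factor `(a q x_k / x_ℓ; q)_n`; here `ℓ = n + 1` and `x_ℓ` is the last entry. -/
def lastPoch {n : ℕ} (q a : K) (x : Fin (n + 1) → K) (k : Fin (n + 1)) (e : ℤ) : K :=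
  qPoch q (a * q * (x k / x (Fin.last n))) e

/-- The factor `(q x_r x_s q^{j_r + j_s}; q)_{i_r - j_r}`. -/
def prodPoch (q : K) (x : Fin m → K) (i j : Fin m → ℕ) (r s : Fin m) : K :=
  qPoch q (q * x r * x s * q ^ (j r + j s)) ((i r : ℤ) - j r)

/-- The factor `(x_r x_s q^{j_r + i_s}; q)_{i_r - j_r}`. -/
def prodPochStar (q : K) (x : Fin m → K) (i j : Fin m → ℕ) (r s : Fin m) : K :=
  qPoch q (x r * x s * q ^ (j r + i s)) ((i r : ℤ) - j r)

/-- The Bailey transform matrix `M(i; j; G)`, `G = A_ℓ` or `C_ℓ`, `ℓ = n + 1`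
(`a` plays no role for `C_ℓ`). -/
def baileyM {n : ℕ} (G : RootFamily) (q a : K) (x : Fin (n + 1) → K)
    (i j : Fin (n + 1) → ℕ) : K :=
  match G with
  | .A => (∏ r, ∏ s, (ratioPoch q x i j r s)⁻¹) * ∏ k, (lastPoch q a x k (i k + vecSum j))⁻¹
  | .C => ∏ r, ∏ s, ((ratioPoch q x i j r s)⁻¹ * (prodPoch q x i j r s)⁻¹)

/-- The matrix `M*(i; j; G)`, `G = A_ℓ` or `C_ℓ`, `ℓ = n + 1`. -/
def baileyMStar {n : ℕ} (G : RootFamily) (q a : K) (x : Fin (n + 1) → K)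
    (i j : Fin (n + 1) → ℕ) : K :=
  match G with
  | .A =>
      (∏ k, (1 - a * (x k / x (Fin.last n)) * q ^ (i k + vecSum i))) *
        (∏ k, lastPoch q a x k (j k + vecSum i - 1)) *
        (∏ r, ∏ s, (ratioPoch q x i j r s)⁻¹) *
        signPow q (vecSum i - vecSum j)
  | .C =>
      (∏ r, ∏ s, ((ratioPoch q x i j r s)⁻¹ * (prodPochStar q x i j r s)⁻¹)) *
        (∏ r, ∏ s ∈ Finset.Ioi r,
          ((1 - x r * x s * q ^ (j r + j s)) / (1 - x r * x s * q ^ (i r + i s)))) *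
        signPow q (vecSum i - vecSum j)

/-- None of the denominators in the entries of `M` and `M*` on or below the diagonal
vanishes. For `A_ℓ`, the factor `1 - a x_k / x_ℓ` is the denominator of
`(a q x_k / x_ℓ; q)_{-1}`, which occurs in `M*(0; 0)`. -/
def DenominatorsNeZero {n : ℕ} (G : RootFamily) (q a : K) (x : Fin (n + 1) → K) : Prop :=
  (∀ k, x k ≠ 0) ∧
  (∀ i j : Fin (n + 1) → ℕ, j ≤ i → ∀ r s, ratioPoch q x i j r s ≠ 0) ∧
  match G with
  | .A =>
      (∀ i j : Fin (n + 1) → ℕ, j ≤ i → ∀ k, lastPoch q a x k (i k + vecSum j) ≠ 0) ∧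
      (∀ k, 1 - a * (x k / x (Fin.last n)) ≠ 0)
  | .C =>
      (∀ i j : Fin (n + 1) → ℕ, j ≤ i → ∀ r s, prodPoch q x i j r s ≠ 0) ∧
      (∀ i j : Fin (n + 1) → ℕ, j ≤ i → ∀ r s, prodPochStar q x i j r s ≠ 0) ∧
      (∀ (i : Fin (n + 1) → ℕ) (r s), r < s → 1 - x r * x s * q ^ (i r + i s) ≠ 0)

/-- `A` and `B` form a `G`-Bailey pair: `B_N = ∑_{0 ≤ y_k ≤ N_k} M(N; y; G) A_y` for all `N`. -/
def IsBaileyPair {n : ℕ} (G : RootFamily) (q a : K) (x : Fin (n + 1) → K)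
    (A B : (Fin (n + 1) → ℕ) → K) : Prop :=
  ∀ N, B N = ∑ y ∈ Finset.Icc 0 N, baileyM G q a x N y * A y

end BaileyDefs

/-! Both matrices are lower triangular, so it is enough that M* is a left inverse of M: ∑_z M*(N;z)
M(z;y) is 1 for y = N and 0 otherwise (`forall_eq_sum_iff_of_sum_mul_eq_ite`). The diagonal case is
a direct cancellation.

Off the diagonal, put d = N - y and absorb q^{y_k} into x_k. The nodes x_k q^t with t ≤ d_k form one
group for each k, and z selects one node u_k = x_k q^{z_k} from each group. Up to a factor free of
z, the part of the summand common to both families is the product of the nodal weights of the u_k,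
taken among all nodes, times the Vandermonde product ∏_{i<j} (u_i - u_j) (`ratio_kernel_eq`). The
other factors are ∏ p(u_k) for A, with deg p ≤ |d| - 1, and essentially ∏_{i<j} (1 - u_i u_j) ∏
p(u_k) for C.

Such a sum is a divided difference in disguise. Choose k₀ with d_{k₀} ≠ 0 and let the variable
u_{k₀} run over all nodes of all groups. The degree in u_{k₀} is at most the number of nodes minus
2, so this sum vanishes. The terms in which u_{k₀} lies in a group k ≠ k₀ involve two nodes of that
group and cancel in pairs by antisymmetry. What remains is the required sum
(`sum_box_eq_zero_of_alternating`). -/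

/-! ### Divided differences of low-degree polynomials. -/

open Finset Polynomial in
/-- The sum of the values of a polynomial of degree at most `#s - 2`, weighted by the nodal
weights, vanishes. -/
theorem sum_nodalWeight_mul_eval_eq_zero {ι F : Type*} [Field F] [DecidableEq ι] {s : Finset ι}
    {v : ι → F} (hvs : Set.InjOn v s) {P : F[X]} (hP : P.natDegree + 2 ≤ #s) :
    ∑ i ∈ s, Lagrange.nodalWeight s v i * P.eval (v i) = 0 := by
  have h1 : P.degree < #s :=
    lt_of_le_of_lt degree_le_natDegree (by exact_mod_cast (by omega : P.natDegree < #s))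
  -- By Lagrange interpolation the weighted sum is the coefficient of X^(#s - 1) in `P`.
  have h2 := Lagrange.coeff_eq_sum hvs h1
  rw [coeff_eq_zero_of_natDegree_lt (by omega)] at h2
  rw [h2]
  refine sum_congr rfl fun i _ => ?_
  rw [Lagrange.nodalWeight, prod_inv_distrib, div_eq_mul_inv, mul_comm]

/-! ### Sums of alternating functions over a box. -/

section BoxSum

open Finset Function

variable {ι K : Type*} [Fintype ι] [DecidableEq ι]

theorem sum_box_prod_swap [AddCommMonoid K] (N : ι → ℕ) (k : ι) (f : (ι → ℕ) × ℕ → K) :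
    ∑ p ∈ Icc 0 N ×ˢ range (N k + 1), f p =
      ∑ p ∈ Icc 0 N ×ˢ range (N k + 1), f (update p.1 k p.2, p.1 k) := by
  have hmem : ∀ p ∈ Icc 0 N ×ˢ range (N k + 1),
      ((update p.1 k p.2, p.1 k) : (ι → ℕ) × ℕ) ∈ Icc 0 N ×ˢ range (N k + 1) := by
    rintro ⟨z, t⟩ h
    simp only [mem_product, mem_Icc, mem_range, zero_le, true_and] at h ⊢
    have hk : z k ≤ N k := h.1 k
    refine ⟨fun j => ?_, by omega⟩
    rcases eq_or_ne j k with rfl | hj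
    · simp only [update_self]; omega
    · simpa only [update_of_ne hj] using h.1 j
  refine sum_nbij' (fun p => (update p.1 k p.2, p.1 k)) (fun p => (update p.1 k p.2, p.1 k))
    hmem hmem ?_ ?_ ?_ <;> simp

/-- `hsum` puts every node of every group into slot `k₀`. For a group `k ≠ k₀`, exchanging `z k`
with `t` preserves the weights and, by `hswap`, changes the sign of `P`, so only the group `k₀`
contributes. -/
theorem sum_box_eq_zero_of_alternating [Field K] [CharZero K] (N : ι → ℕ) (w v : ι → ℕ → K)
    (P : (ι → K) → K) (k₀ : ι)
    (hsum : ∀ z ≤ N, ∑ k, ∑ t ∈ range (N k + 1),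
      w k t * P (update (fun j => v j (z j)) k₀ (v k t)) = 0)
    (hswap : ∀ z ≤ N, ∀ k ≠ k₀, ∀ t ≤ N k,
      P (update (fun j => v j (z j)) k₀ (v k t)) =
        -P (update (fun j => v j (update z k t j)) k₀ (v k (z k)))) :
    ∑ z ∈ Icc 0 N, (∏ k, w k (z k)) * P (fun k => v k (z k)) = 0 := by
  -- The coordinate `p.1 k₀` is a dummy for `f`; keeping it lets all sums range over the full box.
  set f : ι → (ι → ℕ) × ℕ → K := fun k p =>
    (∏ j ∈ univ.erase k₀, w j (p.1 j)) *
      (w k p.2 * P (update (fun j => v j (p.1 j)) k₀ (v k p.2))) with hf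
  have htotal : ∑ k, ∑ p ∈ Icc 0 N ×ˢ range (N k + 1), f k p = 0 := by
    simp_rw [sum_product, hf, ← mul_sum]
    rw [sum_comm]
    refine sum_eq_zero fun z hz => ?_
    rw [← mul_sum, hsum z (mem_Icc.1 hz).2, mul_zero]
  have hother : ∀ k ≠ k₀, ∑ p ∈ Icc 0 N ×ˢ range (N k + 1), f k p = 0 := by
    intro k hk
    have hneg : ∑ p ∈ Icc 0 N ×ˢ range (N k + 1), f k p =
        -∑ p ∈ Icc 0 N ×ˢ range (N k + 1), f k p := by
      conv_lhs => rw [sum_box_prod_swap]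
      rw [← sum_neg_distrib]
      refine sum_congr rfl ?_
      rintro ⟨z, t⟩ h
      simp only [mem_product, mem_Icc, mem_range, zero_le, true_and] at h
      have hk' : k ∈ univ.erase k₀ := by simp [hk]
      have hw : ∏ j ∈ (univ.erase k₀).erase k, w j (update z k t j) =
          ∏ j ∈ (univ.erase k₀).erase k, w j (z j) :=
        prod_congr rfl fun j hj => by rw [update_of_ne (ne_of_mem_erase hj)]
      simp only [hf]
      rw [hswap z h.1 k hk t (by omega), ← mul_prod_erase _ _ hk', ← mul_prod_erase _ _ hk', hw,
        update_self]
      ring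
    exact self_eq_neg.1 hneg
  rw [sum_eq_single k₀ (fun k _ hk => hother k hk) (by simp), sum_box_prod_swap] at htotal
  have hterm : ∀ p ∈ Icc 0 N ×ˢ range (N k₀ + 1), f k₀ (update p.1 k₀ p.2, p.1 k₀) =
      (∏ k, w k (p.1 k)) * P (fun k => v k (p.1 k)) := by
    rintro ⟨z, t⟩ -
    have hw : ∏ j ∈ univ.erase k₀, w j (update z k₀ t j) = ∏ j ∈ univ.erase k₀, w j (z j) :=
      prod_congr rfl fun j hj => by rw [update_of_ne (ne_of_mem_erase hj)]
    have hX : update (fun j => v j (update z k₀ t j)) k₀ (v k₀ (z k₀)) = fun j => v j (z j) := by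
      funext j
      rcases eq_or_ne j k₀ with rfl | hj
      · simp
      · simp [hj]
    simp only [hf]
    rw [hX, hw, ← mul_prod_erase univ _ (mem_univ k₀)]
    ring
  -- After the exchange the dummy is the second component; it only contributes the factor `N k₀ +
  -- 1`, nonzero in characteristic zero.
  rw [sum_congr rfl hterm, sum_product_right] at htotal
  simpa [Nat.cast_add_one_ne_zero] using htotal

end BoxSum

/-! ### Alternating products and their degree in one variable. -/

section Alternant

open Finset Function Polynomial

variable {K : Type*} [Field K] {m : ℕ}

/-- The factor `(u_i - u_j) (1 - u_i u_j)`, where the second factor is present only if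
`i, j ∈ s`. -/
def alternantFactor {R : Type*} [CommRing R] (s : Finset (Fin m)) (u : Fin m → R)
    (i j : Fin m) : R :=
  (u i - u j) * (1 - if i ∈ s ∧ j ∈ s then u i * u j else 0)

/-- The product of all `alternantFactor`s and of the values of a polynomial `p`; it is
alternating in the variables from `s`, and in the other ones. -/
noncomputable def alternant (s : Finset (Fin m)) (p : K[X]) (u : Fin m → K) : K :=
  (∏ i, ∏ j ∈ Ioi i, alternantFactor s u i j) * ∏ k, p.eval (u k)

theorem alternant_eq_zero (s : Finset (Fin m)) (p : K[X]) {u : Fin m → K} {i j : Fin m}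
    (hij : i ≠ j) (h : u i = u j) : alternant s p u = 0 := by
  wlog hlt : i < j generalizing i j
  · exact this hij.symm h.symm (lt_of_le_of_ne (not_lt.1 hlt) hij.symm)
  rw [alternant, prod_eq_zero (mem_univ i), zero_mul]
  exact prod_eq_zero (mem_Ioi.2 hlt) (by simp [alternantFactor, h])

theorem alternant_comp_swap (s : Finset (Fin m)) (p : K[X]) (u : Fin m → K) {i j : Fin m}
    (hij : i ≠ j) (h : i ∈ s ↔ j ∈ s) :
    alternant s p (u ∘ Equiv.swap i j) = -alternant s p u := by
  have hmem : ∀ k, Equiv.swap i j k ∈ s ↔ k ∈ s := by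
    intro k
    rw [Equiv.swap_apply_def]
    split_ifs with h1 h2
    · rw [h1, h]
    · rw [h2, h]
    · rfl
  have h1 := Equiv.Perm.prod_Ioi_comp_eq_sign_mul_prod (Equiv.swap i j)
    (f := alternantFactor s u) (fun k l => by simp only [alternantFactor, and_comm, mul_comm]; ring)
  have h2 : ∀ k l, alternantFactor s u (Equiv.swap i j k) (Equiv.swap i j l) =
      alternantFactor s (u ∘ Equiv.swap i j) k l := fun k l => by simp [alternantFactor, hmem]
  simp_rw [h2] at h1
  have h3 : ∏ k, p.eval ((u ∘ Equiv.swap i j) k) = ∏ k, p.eval (u k) :=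
    Equiv.prod_comp (Equiv.swap i j) fun k => p.eval (u k)
  rw [alternant, alternant, h1, h3, Equiv.Perm.sign_swap hij]
  simp

/-- For each `j ≠ k₀` exactly one factor pairs `k₀` with `j`: the difference has degree one, and so
has 1 - u_i u_j if present. All other pairs are constant. -/
theorem exists_polynomial_eval_eq_alternant_update (s : Finset (Fin m)) (p : K[X])
    (u : Fin m → K) (k₀ : Fin m) :
    ∃ R : K[X], (∀ c, R.eval c = alternant s p (update u k₀ c)) ∧
      R.natDegree ≤ ∑ j ∈ univ.erase k₀, (1 + if k₀ ∈ s ∧ j ∈ s then 1 else 0) + p.natDegree := by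
  set Y : Fin m → K[X] := update (fun j => C (u j)) k₀ X with hY
  set δ : Fin m → ℕ := fun j => if j = k₀ then 1 else 0 with hδ
  have hYeval : ∀ c j, (Y j).eval c = update u k₀ c j := by
    intro c j
    rcases eq_or_ne j k₀ with rfl | hj
    · simp [hY]
    · simp [hY, hj]
  have hYdeg : ∀ j, (Y j).natDegree ≤ δ j := by
    intro j
    rcases eq_or_ne j k₀ with rfl | hj
    · simp [hY, hδ]
    · simp [hY, hδ, hj]
  set e : Fin m → Fin m → ℕ := fun i j => if i ∈ s ∧ j ∈ s then 1 else 0 with he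
  have hfdeg : ∀ i j, (alternantFactor s Y i j).natDegree ≤ δ j * (1 + e j i) + δ i * (1 + e i j) := by
    intro i j
    have h1 : (Y i - Y j).natDegree ≤ δ i + δ j :=
      (natDegree_sub_le _ _).trans (max_le ((hYdeg i).trans (by omega)) ((hYdeg j).trans (by omega)))
    have h2 : (1 - if i ∈ s ∧ j ∈ s then Y i * Y j else 0).natDegree ≤ e i j * (δ i + δ j) := by
      simp only [he]
      split_ifs
      · refine (natDegree_sub_le _ _).trans (max_le (by simp) ?_)
        rw [one_mul]
        exact natDegree_mul_le.trans (add_le_add (hYdeg i) (hYdeg j))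
      · simp
    have h3 : e j i = e i j := by simp only [he, and_comm]
    refine (natDegree_mul_le.trans (add_le_add h1 h2)).trans (le_of_eq ?_)
    rw [h3]; ring
  refine ⟨(∏ i, ∏ j ∈ Ioi i, alternantFactor s Y i j) *
    (p * ∏ k ∈ univ.erase k₀, C (p.eval (u k))), fun c => ?_, ?_⟩
  · have h1 : ∀ i j, (alternantFactor s Y i j).eval c = alternantFactor s (update u k₀ c) i j := by
      intro i j
      simp only [alternantFactor, eval_mul, eval_sub, hYeval, eval_one]
      split_ifs <;> simp [hYeval]
    have h2 : ∏ k, p.eval (update u k₀ c k) = p.eval c * ∏ k ∈ univ.erase k₀, p.eval (u k) := by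
      rw [← mul_prod_erase univ _ (mem_univ k₀), update_self]
      congr 1
      exact prod_congr rfl fun k hk => by rw [update_of_ne (ne_of_mem_erase hk)]
    simp only [alternant, eval_mul, eval_prod, h1, eval_C, h2]
  · refine natDegree_mul_le.trans (add_le_add ?_ ?_)
    · calc _ ≤ ∑ i, ∑ j ∈ Ioi i, (δ j * (1 + e j i) + δ i * (1 + e i j)) :=
            (natDegree_prod_le _ _).trans (sum_le_sum fun i _ =>
              (natDegree_prod_le _ _).trans (sum_le_sum fun j _ => hfdeg i j))
        _ = ∑ i, ∑ j ∈ {i}ᶜ, δ j * (1 + e j i) :=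
            sum_sum_Ioi_add_eq_sum_sum_off_diag fun j i => δ j * (1 + e j i)
        _ = ∑ j ∈ univ.erase k₀, (1 + e k₀ j) := by
            have : ∀ i, ∑ j ∈ {i}ᶜ, δ j * (1 + e j i) = if i = k₀ then 0 else 1 + e k₀ i := by
              intro i
              rcases eq_or_ne i k₀ with rfl | hi
              · rw [if_pos rfl]
                exact sum_eq_zero fun j hj => by
                  simp only [mem_compl, mem_singleton] at hj
                  simp [hδ, hj]
              · rw [if_neg hi, sum_eq_single k₀]
                · simp [hδ]
                · intro j _ hj; simp [hδ, hj]
                · intro h; simp [hi.symm] at h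
            simp_rw [this]
            rw [← add_sum_erase univ _ (mem_univ k₀), if_pos rfl, zero_add]
            exact sum_congr rfl fun j hj => if_neg (ne_of_mem_erase hj)
    · rw [← map_prod]
      exact natDegree_mul_C_le _ _

/-- The finite set of labels of the nodes `x_k q^t`, `t ≤ N_k`. -/
def nodeLabels (N : Fin m → ℕ) : Finset (Σ _ : Fin m, ℕ) := univ.sigma fun k => range (N k + 1)

/-- The nodes `x_k q^t`. -/
def qNode (q : K) (x : Fin m → K) (b : Σ _ : Fin m, ℕ) : K := x b.1 * q ^ b.2

/-- There are ∑ N_k + m nodes, and the m - 1 Vandermonde factors containing the variable `k₀` use up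
m - 1 of the degree; `hdeg` is the remaining budget. By `hs`, an index that may not be exchanged
with `k₀` has a group with a single node. -/
theorem sum_box_nodalWeight_mul_alternant_eq_zero [CharZero K] (q : K) (x : Fin m → K)
    (N : Fin m → ℕ) (hinj : Set.InjOn (qNode q x) (nodeLabels N)) (s : Finset (Fin m)) (p : K[X])
    (k₀ : Fin m) (hs : ∀ k, (k ∈ s ↔ k₀ ∈ s) ∨ N k = 0)
    (hdeg : ∑ j ∈ univ.erase k₀, (if k₀ ∈ s ∧ j ∈ s then 1 else 0) + p.natDegree + 1 ≤
      ∑ k, N k) :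
    ∑ z ∈ Icc 0 N, (∏ k, Lagrange.nodalWeight (nodeLabels N) (qNode q x) ⟨k, z k⟩) *
      alternant s p (fun k => x k * q ^ z k) = 0 := by
  refine sum_box_eq_zero_of_alternating N
    (fun k t => Lagrange.nodalWeight (nodeLabels N) (qNode q x) ⟨k, t⟩) (fun k t => x k * q ^ t)
    (alternant s p) k₀ (fun z _ => ?_) (fun z hz k hk t ht => ?_)
  · obtain ⟨R, hR, hRdeg⟩ :=
      exists_polynomial_eval_eq_alternant_update s p (fun j => x j * q ^ z j) k₀
    have hcard : #(nodeLabels N) = ∑ k, N k + (#(univ.erase k₀) + 1) := by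
      rw [card_erase_add_one (mem_univ k₀), nodeLabels, card_sigma]
      simp [sum_add_distrib]
    rw [sum_add_distrib, sum_const, smul_eq_mul, mul_one] at hRdeg
    have h := sum_nodalWeight_mul_eval_eq_zero hinj (P := R) (by omega)
    rw [nodeLabels, sum_sigma] at h
    simp_rw [← hR]
    exact h
  · rcases hs k with h | h
    · rw [← alternant_comp_swap s p _ hk h]
      congr 1
      funext j
      simp only [comp_apply]
      rcases eq_or_ne j k with rfl | hjk
      · simp [hk]
      · rcases eq_or_ne j k₀ with rfl | hj0
        · simp [hk]
        · rw [Equiv.swap_apply_of_ne_of_ne hjk hj0, update_of_ne hj0, update_of_ne hj0,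
            update_of_ne hjk]
    -- Slot `k₀` repeats the only node of group `k`, so both sides vanish.
    · have hzk : z k ≤ N k := hz k
      have h0 : t = 0 ∧ z k = 0 := by omega
      rw [alternant_eq_zero s p hk (by simp [hk, h0]), alternant_eq_zero s p hk (by simp [hk, h0]),
        neg_zero]

end Alternant

/-! ### The common kernel in terms of nodal weights. -/

section Kernel

open Finset

theorem qPoch_natCast {K : Type*} [Field K] (q α : K) (n : ℕ) :
    qPoch q α (n : ℤ) = ∏ k ∈ range n, (1 - α * q ^ k) := rfl

theorem prod_prod_eq_prod_diag_mul_prod_Ioi {M : Type*} [CommMonoid M] {m : ℕ}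
    (g : Fin m → Fin m → M) :
    ∏ i, ∏ j, g i j = (∏ i, g i i) * ∏ i, ∏ j ∈ Ioi i, (g i j * g j i) := by
  rw [prod_prod_Ioi_mul_eq_prod_prod_off_diag fun j i => g i j, ← prod_mul_distrib]
  refine prod_congr rfl fun i _ => ?_
  rw [← prod_singleton (fun j => g i j) i, prod_mul_prod_compl]

theorem sum_sum_eq_sum_diag_add_sum_Ioi {M : Type*} [AddCommMonoid M] {m : ℕ}
    (g : Fin m → Fin m → M) :
    ∑ i, ∑ j, g i j = (∑ i, g i i) + ∑ i, ∑ j ∈ Ioi i, (g i j + g j i) := by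
  rw [sum_sum_Ioi_add_eq_sum_sum_off_diag fun j i => g i j, ← sum_add_distrib]
  refine sum_congr rfl fun i _ => ?_
  rw [← sum_singleton (fun j => g i j) i, sum_add_sum_compl]

variable {K : Type*} [Field K] {m : ℕ}

theorem Int.two_mul_mul_pred_div_two (d : ℤ) : 2 * (d * (d - 1) / 2) = d * (d - 1) :=
  Int.mul_ediv_cancel' (Int.even_mul_pred_self d).two_dvd

theorem signPow_zero (q : K) : signPow q 0 = 1 := by simp [signPow]

theorem signPow_add {q : K} (hq : q ≠ 0) (c d : ℤ) :
    signPow q (c + d) = signPow q c * signPow q d * q ^ (c * d) := by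
  have h : (c + d) * (c + d - 1) / 2 = c * (c - 1) / 2 + d * (d - 1) / 2 + c * d := by
    have h1 := Int.two_mul_mul_pred_div_two c
    have h2 := Int.two_mul_mul_pred_div_two d
    have h3 := Int.two_mul_mul_pred_div_two (c + d)
    linarith
  rw [signPow, signPow, signPow, h, zpow_add₀ hq, zpow_add₀ hq,
    zpow_add₀ (neg_ne_zero.2 one_ne_zero)]
  ring

/-- The binomial coefficient of a sum produces the cross terms z_i z_j; these are the powers of q in
the exchange identity `prod_sub_mul_prod_sub_mul_sub`. -/
theorem signPow_vecSum {q : K} (hq : q ≠ 0) (z : Fin m → ℕ) :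
    signPow q (vecSum z) =
      (∏ i, signPow q (z i)) * ∏ i, ∏ j ∈ Ioi i, q ^ (z i * z j) := by
  have hexp : vecSum z * (vecSum z - 1) / 2 =
      ∑ i, (z i : ℤ) * ((z i : ℤ) - 1) / 2 + ∑ i, ∑ j ∈ Ioi i, (z i : ℤ) * z j := by
    have h1 := Int.two_mul_mul_pred_div_two (vecSum z)
    have h2 : ∑ i, (2 : ℤ) * ((z i : ℤ) * ((z i : ℤ) - 1) / 2) =
        ∑ i, (z i : ℤ) * ((z i : ℤ) - 1) :=
      sum_congr rfl fun i _ => Int.two_mul_mul_pred_div_two _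
    have h3 := sum_sum_eq_sum_diag_add_sum_Ioi fun i j : Fin m => (z i : ℤ) * z j
    have h4 : ∑ i, ∑ j ∈ Ioi i, ((z i : ℤ) * z j + z j * z i) =
        2 * ∑ i, ∑ j ∈ Ioi i, (z i : ℤ) * z j := by
      simp_rw [mul_sum]
      exact sum_congr rfl fun i _ => sum_congr rfl fun j _ => by ring
    rw [h4, ← sum_mul_sum] at h3
    rw [← mul_sum] at h2
    simp_rw [mul_sub, mul_one, sum_sub_distrib] at h2
    simp only [vecSum] at h1 ⊢
    simp_rw [mul_sub, mul_one] at h1 ⊢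
    linarith
  have hprod : ∀ f : Fin m → ℤ, ∀ c : K, c ≠ 0 → ∀ s : Finset (Fin m),
      c ^ (∑ i ∈ s, f i) = ∏ i ∈ s, c ^ f i := by
    intro f c hc s
    induction s using Finset.cons_induction with
    | empty => simp
    | cons a s ha ih => rw [sum_cons, prod_cons, zpow_add₀ hc, ih]
  simp only [signPow]
  rw [hexp, zpow_add₀ hq, prod_mul_distrib, hprod _ q hq, hprod _ q hq, vecSum,
    hprod _ (-1) (neg_ne_zero.2 one_ne_zero), mul_assoc]
  congr 2
  refine prod_congr rfl fun i _ => ?_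
  rw [hprod _ q hq]
  exact prod_congr rfl fun j _ => by exact_mod_cast zpow_natCast q (z i * z j)

/-- The exchange identity for a pair of geometric progressions. -/
theorem prod_sub_mul_prod_sub_mul_sub (q u v : K) (a b : ℕ) :
    (∏ t ∈ range a, (v * q ^ b - u * q ^ t)) * (∏ t ∈ range b, (u * q ^ a - v * q ^ t)) *
        (u * q ^ a - v * q ^ b) =
      q ^ (a * b) * ((∏ t ∈ range a, (v - u * q ^ (t + 1))) *
        ∏ t ∈ range b, (u - v * q ^ (t + 1))) * (u - v) := by
  induction a with
  | zero =>
    have h : (∏ t ∈ range b, (u - v * q ^ t)) * (u - v * q ^ b) =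
        (∏ t ∈ range b, (u - v * q ^ (t + 1))) * (u - v) := by
      rw [← prod_range_succ fun t => u - v * q ^ t, prod_range_succ']
      simp
    simpa using h
  | succ a ih =>
    have h1 : (∏ t ∈ range b, (u * q ^ (a + 1) - v * q ^ t)) * (u * q ^ (a + 1) - v * q ^ b) =
        q ^ b * (∏ t ∈ range b, (u * q ^ a - v * q ^ t)) * (u * q ^ (a + 1) - v) := by
      rw [← prod_range_succ fun t => u * q ^ (a + 1) - v * q ^ t, prod_range_succ']
      have h2 : ∀ t, u * q ^ (a + 1) - v * q ^ (t + 1) = q * (u * q ^ a - v * q ^ t) := by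
        intro t; ring
      simp_rw [h2, prod_mul_distrib, prod_const, card_range]
      simp
    rw [prod_range_succ, mul_assoc, h1, prod_range_succ]
    linear_combination q ^ b * (v - u * q ^ (a + 1)) * ih

theorem prod_sub_eq_signPow_mul {q : K} (hq : q ≠ 0) (u : K) (a : ℕ) :
    ∏ t ∈ range a, (u * q ^ a - u * q ^ t) =
      signPow q a * ∏ t ∈ range a, (u - u * q ^ (t + 1)) := by
  induction a with
  | zero => simp [signPow_zero]
  | succ a ih =>
    have h : signPow q ((a + 1 : ℕ) : ℤ) = -(signPow q a * q ^ a) := by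
      rw [Nat.cast_add, Nat.cast_one, signPow_add hq]
      simp [signPow]
    have h2 : ∀ t, u * q ^ (a + 1) - u * q ^ (t + 1) = q * (u * q ^ a - u * q ^ t) := by
      intro t; ring
    rw [prod_range_succ', h, prod_range_succ]
    simp_rw [h2, prod_mul_distrib, prod_const, card_range, ih]
    ring

/-- The exchange identity is applied to each pair (r, s), (s, r) together with its Vandermonde
factor, and `prod_sub_eq_signPow_mul` to the diagonal. -/
theorem prod_node_sub_mul_prod_sub {q : K} (hq : q ≠ 0) (x : Fin m → K) (z : Fin m → ℕ) :
    (∏ r, ∏ s, ∏ t ∈ range (z r), (x s * q ^ z s - x r * q ^ t)) *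
        (∏ i, ∏ j ∈ Ioi i, (x i * q ^ z i - x j * q ^ z j)) =
      signPow q (vecSum z) * (∏ r, ∏ s, ∏ t ∈ range (z r), (x s - x r * q ^ (t + 1))) *
        ∏ i, ∏ j ∈ Ioi i, (x i - x j) := by
  rw [prod_prod_eq_prod_diag_mul_prod_Ioi fun r s => ∏ t ∈ range (z r), (x s * q ^ z s - x r * q ^ t),
    prod_prod_eq_prod_diag_mul_prod_Ioi fun r s => ∏ t ∈ range (z r), (x s - x r * q ^ (t + 1)),
    signPow_vecSum hq, mul_assoc]
  simp_rw [← prod_mul_distrib, prod_sub_mul_prod_sub_mul_sub, prod_sub_eq_signPow_mul hq]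
  simp_rw [prod_mul_distrib]
  ring

/-- In each group r the nodes split into those below, above and at level z_r. The lower ones lead to
M(z;0), the upper ones to M*(N;z), and the selected ones to a squared Vandermonde product up to
sign. -/
theorem inv_nodalWeight_eq (q : K) (x : Fin m → K) {N z : Fin m → ℕ} (hz : z ≤ N) (s : Fin m) :
    (Lagrange.nodalWeight (nodeLabels N) (qNode q x) ⟨s, z s⟩)⁻¹ =
      (∏ r, ∏ t ∈ range (z r), (x s * q ^ z s - x r * q ^ t)) *
        (∏ r, ∏ t ∈ range (N r - z r), (x s * q ^ z s - x r * q ^ z r * q ^ (t + 1))) *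
        ∏ r ∈ {s}ᶜ, (x s * q ^ z s - x r * q ^ z r) := by
  have hsplit : ∀ r, (∏ t ∈ (range (N r + 1)).erase (z r), (x s * q ^ z s - x r * q ^ t)) =
      (∏ t ∈ range (z r), (x s * q ^ z s - x r * q ^ t)) *
        ∏ t ∈ range (N r - z r), (x s * q ^ z s - x r * q ^ z r * q ^ (t + 1)) := by
    intro r
    have hzr : z r ≤ N r := hz r
    have hset : (range (N r + 1)).erase (z r) = (range (z r)).disjUnion
        ((range (N r - z r)).map (addLeftEmbedding (z r + 1))) (by
          rw [disjoint_left]; intro t; simp; omega) := by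
      ext t
      simp only [mem_erase, mem_range, mem_disjUnion, mem_map, addLeftEmbedding_apply]
      constructor
      · rintro ⟨h1, h2⟩
        rcases lt_or_gt_of_ne h1 with h | h
        · exact Or.inl h
        · exact Or.inr ⟨t - (z r + 1), by omega, by omega⟩
      · rintro (h | ⟨a, h1, rfl⟩) <;> omega
    rw [hset, prod_disjUnion, prod_map]
    congr 1
    exact prod_congr rfl fun t _ => by rw [addLeftEmbedding_apply]; ring
  have hlabels : (nodeLabels N).erase ⟨s, z s⟩ = univ.sigma fun r =>
      if r = s then (range (N r + 1)).erase (z r) else range (N r + 1) := by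
    ext ⟨r, t⟩
    simp only [nodeLabels, mem_erase, mem_sigma, mem_univ, true_and]
    rcases eq_or_ne r s with rfl | hr
    · simp
    · simp [hr]
  rw [Lagrange.nodalWeight, prod_inv_distrib, inv_inv, hlabels, prod_sigma]
  simp only [qNode]
  rw [← prod_mul_distrib]
  simp_rw [← hsplit]
  rw [← mul_prod_erase univ _ (mem_univ s),
    ← mul_prod_erase univ (fun r => ∏ t ∈ (range (N r + 1)).erase (z r), _) (mem_univ s), if_pos rfl,
    mul_assoc, ← compl_singleton, ← prod_mul_distrib]
  congr 1
  refine prod_congr rfl fun r hr => ?_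
  have hr' : r ≠ s := by simpa using hr
  rw [if_neg hr', prod_erase_mul]
  rw [mem_range]; exact Nat.lt_succ_of_le (hz r)

theorem prod_one_sub_div_mul_prod_pow {q : K} {x : Fin m → K} (hx : ∀ k, x k ≠ 0)
    (d : Fin m → ℕ) :
    (∏ r, ∏ s, qPoch q (q * (x r / x s)) (d r)) * (∏ s, x s) ^ (∑ k, d k) =
      ∏ r, ∏ s, ∏ t ∈ range (d r), (x s - x r * q ^ (t + 1)) := by
  rw [← prod_pow_eq_pow_sum, ← prod_mul_distrib]
  refine prod_congr rfl fun r _ => ?_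
  rw [← prod_pow, ← prod_mul_distrib]
  refine prod_congr rfl fun s _ => ?_
  rw [qPoch_natCast, ← card_range (d r), ← prod_const, card_range, ← prod_mul_distrib]
  refine prod_congr rfl fun t _ => ?_
  have := hx s
  field_simp
  ring

/-- The part of `M*(N; z) M(z; 0)` common to both families, in terms of nodal weights. -/
theorem ratio_kernel_eq {q : K} (hq : q ≠ 0) {x : Fin m → K} (hx : ∀ k, x k ≠ 0)
    {N z : Fin m → ℕ} (hz : z ≤ N) (hinj : Set.InjOn (qNode q x) (nodeLabels N)) :
    (∏ r, ∏ s, qPoch q (q * (x r * q ^ z r / (x s * q ^ z s))) (N r - z r : ℕ))⁻¹ *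
        (∏ r, ∏ s, qPoch q (q * (x r / x s)) (z r))⁻¹ * signPow q (vecSum N - vecSum z) =
      ((∏ i : Fin m, ∏ _j ∈ Ioi i, (-1)) * (∏ s, x s) ^ (∑ k, N k) * signPow q (vecSum N) *
          ∏ i, ∏ j ∈ Ioi i, (x i - x j)) *
        ((∏ k, Lagrange.nodalWeight (nodeLabels N) (qNode q x) ⟨k, z k⟩) *
          ∏ i, ∏ j ∈ Ioi i, (x i * q ^ z i - x j * q ^ z j)) := by
  have hX : ∀ k, x k * q ^ z k ≠ 0 := fun k => mul_ne_zero (hx k) (pow_ne_zero _ hq)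
  have h1 := prod_one_sub_div_mul_prod_pow (q := q) hx z
  have h2 := prod_one_sub_div_mul_prod_pow (q := q) hX fun k => N k - z k
  have h3 := prod_node_sub_mul_prod_sub hq x z
  have h4 := prod_congr (rfl : (univ : Finset (Fin m)) = univ)
    fun s _ => inv_nodalWeight_eq q x hz s
  have hW : ∏ k, Lagrange.nodalWeight (nodeLabels N) (qNode q x) ⟨k, z k⟩ ≠ 0 :=
    prod_ne_zero_iff.2 fun k _ => Lagrange.nodalWeight_ne_zero hinj (by
      simp only [nodeLabels, mem_sigma, mem_univ, mem_range, true_and]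
      exact Nat.lt_succ_of_le (hz k))
  rw [prod_inv_distrib, prod_mul_distrib, prod_mul_distrib,
    ← prod_prod_Ioi_mul_eq_prod_prod_off_diag fun r s => x s * q ^ z s - x r * q ^ z r] at h4
  have hsum : ∑ k, N k = ∑ k, z k + ∑ k, (N k - z k) := by
    rw [← sum_add_distrib]
    exact sum_congr rfl fun k _ => (Nat.add_sub_cancel' (hz k)).symm
  have hvec : ∀ y : Fin m → ℕ, vecSum y = ((∑ k, y k : ℕ) : ℤ) := fun y => by simp [vecSum]
  have hsign : signPow q (vecSum N) = signPow q (vecSum z) * signPow q (vecSum N - vecSum z) *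
      q ^ ((∑ k, z k) * ∑ k, (N k - z k)) := by
    have h := signPow_add hq (vecSum z) (vecSum N - vecSum z)
    rw [add_sub_cancel] at h
    rw [h]
    congr 1
    rw [hvec, hvec, hsum, Nat.cast_add, add_sub_cancel_left]
    exact_mod_cast zpow_natCast q _
  have hneg : ∏ i, ∏ j ∈ Ioi i, ((x i * q ^ z i - x j * q ^ z j) * (x j * q ^ z j - x i * q ^ z i)) =
      (∏ i, ∏ j ∈ Ioi i, (x i * q ^ z i - x j * q ^ z j)) ^ 2 *
        ∏ i : Fin m, ∏ _j ∈ Ioi i, (-1) := by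
    simp_rw [← prod_pow, ← prod_mul_distrib]
    exact prod_congr rfl fun i _ => prod_congr rfl fun j _ => by ring
  -- This power of q is the cross term in `hsign`, so the two cancel.
  have hpow : (∏ s, x s * q ^ z s) ^ (∑ k, (N k - z k)) =
      (∏ s, x s) ^ (∑ k, (N k - z k)) * q ^ ((∑ k, z k) * ∑ k, (N k - z k)) := by
    rw [prod_mul_distrib, prod_pow_eq_pow_sum, mul_pow, pow_mul]
  rw [hneg, prod_comm (f := fun s r => ∏ t ∈ range (z r), (x s * q ^ z s - x r * q ^ t)),
    prod_comm (f := fun s r =>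
      ∏ t ∈ range (N r - z r), (x s * q ^ z s - x r * q ^ z r * q ^ (t + 1))), ← h2, hpow] at h4
  rw [← h1] at h3
  rw [hsum, hsign, pow_add]
  set D1 := ∏ r, ∏ s, qPoch q (q * (x r / x s)) (z r)
  set D2 := ∏ r, ∏ s, qPoch q (q * (x r * q ^ z r / (x s * q ^ z s))) ((N r - z r : ℕ) : ℤ)
  set Q := ∏ r, ∏ s, ∏ t ∈ range (z r), (x s * q ^ z s - x r * q ^ t)
  set V := ∏ i, ∏ j ∈ Ioi i, (x i * q ^ z i - x j * q ^ z j)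
  set V0 := ∏ i, ∏ j ∈ Ioi i, (x i - x j)
  set W := ∏ k, Lagrange.nodalWeight (nodeLabels N) (qNode q x) ⟨k, z k⟩
  set ε : K := ∏ i : Fin m, ∏ _j ∈ Ioi i, (-1)
  set E := q ^ ((∑ k, z k) * ∑ k, (N k - z k))
  have hW' := inv_ne_zero hW
  -- The q-factorials divide the inverse weight, so distinctness of the nodes already makes them
  -- nonzero.
  have hD2 : D2 ≠ 0 := by intro h0; rw [h4, h0] at hW'; simp at hW'
  have hmain : W⁻¹ = D1 * D2 * (signPow q (vecSum z) * (∏ s, x s) ^ (∑ k, z k) *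
      (∏ s, x s) ^ (∑ k, (N k - z k)) * E * V0 * V * ε) := by
    rw [h4]
    linear_combination D2 * (∏ s, x s) ^ (∑ k, (N k - z k)) * E * V * ε * h3
  have hD1 : D1 ≠ 0 := by intro h0; rw [hmain, h0] at hW'; simp at hW'
  have hmain' : 1 = W * (D1 * D2 * (signPow q (vecSum z) * (∏ s, x s) ^ (∑ k, z k) *
      (∏ s, x s) ^ (∑ k, (N k - z k)) * E * V0 * V * ε)) := by
    rw [← hmain, mul_inv_cancel₀ hW]
  field_simp
  linear_combination signPow q (vecSum N - vecSum z) * hmain'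

end Kernel

/-! ### Inversion of lower triangular matrices. -/

section TriangularInversion

open Finset

variable {K : Type*} [Field K] {ι : Type*} [Fintype ι] [DecidableEq ι]

/-- A one-sided inverse of a lower triangular matrix indexed by `ι → ℕ` inverts the associated
transformation of sequences. -/
theorem forall_eq_sum_iff_of_sum_mul_eq_ite (M L : (ι → ℕ) → (ι → ℕ) → K)
    (hLM : ∀ N y, y ≤ N → ∑ z ∈ Icc y N, L N z * M z y = if y = N then 1 else 0)
    (A B : (ι → ℕ) → K) :
    (∀ N, B N = ∑ y ∈ Icc 0 N, M N y * A y) ↔ ∀ N, A N = ∑ y ∈ Icc 0 N, L N y * B y := by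
  have hforward : ∀ (A : (ι → ℕ) → K) N, ∑ z ∈ Icc 0 N, L N z * ∑ y ∈ Icc 0 z, M z y * A y = A N := by
    intro A N
    have hcomm : ∑ z ∈ Icc 0 N, L N z * ∑ y ∈ Icc 0 z, M z y * A y =
        ∑ y ∈ Icc 0 N, ∑ z ∈ Icc y N, L N z * M z y * A y := by
      simp_rw [mul_sum, ← mul_assoc]
      refine sum_comm' fun z y => ?_
      simp only [mem_Icc, zero_le, true_and]
      exact ⟨fun h => ⟨⟨h.2, h.1⟩, h.2.trans h.1⟩, fun h => ⟨h.1.2, h.1.1⟩⟩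
    rw [hcomm, sum_eq_single N]
    · rw [← sum_mul, hLM N N le_rfl, if_pos rfl, one_mul]
    · intro y hy hyN
      rw [← sum_mul, hLM N y (mem_Icc.1 hy).2, if_neg hyN, zero_mul]
    · intro h; simp at h
  constructor
  · intro h N
    simp_rw [h]
    exact (hforward A N).symm
  · intro h
    -- For the converse, `L` applied to `B` and to the transform of `A` gives the same sequence; a
    -- nonzero diagonal lets the values be compared by induction on `N`.
    have hdiag : ∀ N, L N N ≠ 0 := by
      intro N h0
      have h1 := hLM N N le_rfl
      simp [h0] at h1
    intro N
    induction N using WellFoundedLT.induction with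
    | ind N ih =>
      have h1 := (h N).symm.trans (hforward A N).symm
      have hmem : N ∈ Icc 0 N := by simp
      rw [← add_sum_erase _ _ hmem, ← add_sum_erase _ (fun z => L N z * _) hmem,
        sum_congr rfl fun y hy => by
          rw [ih y (lt_of_le_of_ne (mem_Icc.1 (mem_of_mem_erase hy)).2 (ne_of_mem_erase hy))]] at h1
      exact mul_left_cancel₀ (hdiag N) (add_right_cancel h1)

end TriangularInversion

/-! ### Moving the lower corner of a box to the origin. -/

section Reindex

open Finset

variable {ι M : Type*} [Fintype ι] [DecidableEq ι] [AddCommMonoid M]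

theorem sum_Icc_eq_sum_Icc_zero_sub {y N : ι → ℕ} (hy : y ≤ N) (f : (ι → ℕ) → M) :
    ∑ z ∈ Icc y N, f z = ∑ z ∈ Icc 0 (N - y), f (y + z) := by
  refine sum_nbij' (fun z => z - y) (fun z => y + z) ?_ ?_ ?_ ?_ ?_
  · intro z hz
    simp only [mem_Icc, zero_le, true_and] at hz ⊢
    exact fun k => Nat.sub_le_sub_right (hz.2 k) _
  · intro z hz
    simp only [mem_Icc, zero_le, true_and] at hz ⊢
    refine ⟨fun k => Nat.le_add_right _ _, fun k => ?_⟩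
    have h1 : z k ≤ N k - y k := hz k
    have h2 : y k ≤ N k := hy k
    change y k + z k ≤ N k
    omega
  · intro z hz
    exact add_tsub_cancel_of_le (mem_Icc.1 hz).1
  · intro z _
    exact add_tsub_cancel_left _ _
  · intro z hz
    rw [add_tsub_cancel_of_le (mem_Icc.1 hz).1]

end Reindex

/-! ### Matrix entries and distinctness of the nodes. -/

section Entries

open Finset Polynomial

variable {K : Type*} [Field K] {m : ℕ}

theorem qPoch_zero (q α : K) : qPoch q α 0 = 1 := by
  have := qPoch_natCast q α 0
  simpa using this

theorem qPoch_natCast_add (q α : K) (e d : ℕ) :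
    qPoch q α ((e + d : ℕ) : ℤ) = qPoch q α e * ∏ t ∈ range d, (1 - α * q ^ (e + t)) := by
  rw [qPoch_natCast, qPoch_natCast, prod_range_add]

theorem ratioPoch_self (q : K) (x : Fin m → K) (N : Fin m → ℕ) (r s : Fin m) :
    ratioPoch q x N N r s = 1 := by simp [ratioPoch, qPoch_zero]

theorem prodPoch_self (q : K) (x : Fin m → K) (N : Fin m → ℕ) (r s : Fin m) :
    prodPoch q x N N r s = 1 := by simp [prodPoch, qPoch_zero]

theorem prodPochStar_self (q : K) (x : Fin m → K) (N : Fin m → ℕ) (r s : Fin m) :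
    prodPochStar q x N N r s = 1 := by simp [prodPochStar, qPoch_zero]

theorem ratioPoch_eq {q : K} (hq : q ≠ 0) (x : Fin m → K) (i j : Fin m → ℕ) (hij : j ≤ i)
    (r s : Fin m) :
    ratioPoch q x i j r s = qPoch q (q * (x r * q ^ j r / (x s * q ^ j s))) (i r - j r : ℕ) := by
  rw [ratioPoch, Nat.cast_sub (hij r), zpow_sub₀ hq, zpow_natCast, zpow_natCast, mul_div_mul_comm,
    mul_assoc]

theorem vecSum_sub_vecSum_add {y N : Fin m → ℕ} (hy : y ≤ N) (z : Fin m → ℕ) :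
    vecSum N - vecSum (y + z) = vecSum (N - y) - vecSum z := by
  simp only [vecSum, ← sum_sub_distrib, Pi.add_apply, Pi.sub_apply]
  refine sum_congr rfl fun k _ => ?_
  rw [Nat.cast_sub (hy k)]
  push_cast; ring

/-- Each coincidence of two nodes would make some admissible `ratioPoch` denominator vanish. -/
theorem qNode_injOn {q : K} (hq : q ≠ 0) {x : Fin m → K} (hx : ∀ k, x k ≠ 0)
    (h : ∀ i j : Fin m → ℕ, j ≤ i → ∀ r s, ratioPoch q x i j r s ≠ 0) :
    Function.Injective (qNode q x) := by
  have hne : ∀ r s (a b : ℕ), r ≠ s → x r * q ^ a ≠ x s * q ^ b := by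
    intro r s a b hrs heq
    -- The `+ 1` absorbs the leading q of `ratioPoch`: its single factor becomes 1 - x_r q^a / (x_s
    -- q^b).
    set j : Fin m → ℕ := fun k => if k = r then a else b + 1 with hj
    have h1 := h (j + 1) j (fun _ => Nat.le_add_right _ _) r s
    rw [ratioPoch_eq hq x (j + 1) j (fun _ => Nat.le_add_right _ _)] at h1
    simp only [hj, Pi.add_apply, Pi.one_apply, if_pos, if_neg hrs.symm, add_tsub_cancel_left,
      qPoch_natCast, prod_range_one, pow_zero, mul_one, heq] at h1
    apply h1
    have := hx s
    field_simp
    ring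
  have hpow : ∀ e : ℕ, m ≠ 0 → q ^ (e + 1) ≠ 1 := by
    intro e hm heq
    -- For r = s this is (q; q)_{e+1}, whose last factor is 1 - q^{e+1}.
    have h1 := h (fun _ => e + 1) 0 (fun _ => Nat.zero_le _) ⟨0, Nat.pos_of_ne_zero hm⟩
      ⟨0, Nat.pos_of_ne_zero hm⟩
    rw [ratioPoch_eq hq x (fun _ => e + 1) 0 (fun _ => Nat.zero_le _)] at h1
    simp only [Pi.zero_apply, pow_zero, mul_one, div_self (hx _), Nat.sub_zero, qPoch_natCast,
      prod_range_succ, ← pow_succ'] at h1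
    exact h1 (by simp [heq])
  have hlt : ∀ r (a b : ℕ), a < b → x r * q ^ a ≠ x r * q ^ b := by
    intro r a b hab heq
    obtain ⟨e, rfl⟩ := Nat.exists_eq_add_of_lt hab
    refine hpow e (fun hm => by subst hm; exact r.elim0) ?_
    have h2 := mul_left_cancel₀ (hx r) heq
    rw [add_assoc, pow_add] at h2
    exact (mul_left_cancel₀ (pow_ne_zero a hq) (by rw [mul_one]; exact h2)).symm
  rintro ⟨r, a⟩ ⟨s, b⟩ heq
  simp only [qNode] at heq
  rcases eq_or_ne r s with rfl | hrs
  · rcases lt_trichotomy a b with hab | rfl | hab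
    · exact absurd heq (hlt r a b hab)
    · rfl
    · exact absurd heq.symm (hlt r b a hab)
  · exact absurd heq (hne r s a b hrs)

theorem injective_qNode_shift {q : K} {x : Fin m → K} (h : Function.Injective (qNode q x))
    (y : Fin m → ℕ) : Function.Injective (qNode q fun k => x k * q ^ y k) := by
  rintro ⟨r, a⟩ ⟨s, b⟩ heq
  simp only [qNode, mul_assoc, ← pow_add] at heq
  have h1 := @h ⟨r, y r + a⟩ ⟨s, y s + b⟩ heq
  simp only [Sigma.mk.injEq, heq_eq_eq] at h1
  obtain ⟨rfl, h2⟩ := h1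
  rw [Nat.add_left_cancel h2]

/-- The part of `M*(N; y + z) M(y + z; y)` common to both families. -/
theorem ratioPoch_mul_ratioPoch_mul_signPow {q : K} (hq : q ≠ 0) {x : Fin m → K}
    (hx : ∀ k, x k ≠ 0) (hinj : Function.Injective (qNode q x)) {y N z : Fin m → ℕ} (hy : y ≤ N)
    (hz : z ≤ N - y) :
    (∏ r, ∏ s, (ratioPoch q x N (y + z) r s)⁻¹) * (∏ r, ∏ s, (ratioPoch q x (y + z) y r s)⁻¹) *
        signPow q (vecSum N - vecSum (y + z)) =
      ((∏ i : Fin m, ∏ _j ∈ Ioi i, (-1)) * (∏ s, x s * q ^ y s) ^ (∑ k, (N - y) k) *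
          signPow q (vecSum (N - y)) * ∏ i, ∏ j ∈ Ioi i, (x i * q ^ y i - x j * q ^ y j)) *
        ((∏ k, Lagrange.nodalWeight (nodeLabels (N - y)) (qNode q fun k => x k * q ^ y k)
            ⟨k, z k⟩) *
          ∏ i, ∏ j ∈ Ioi i, (x i * q ^ y i * q ^ z i - x j * q ^ y j * q ^ z j)) := by
  have hyz : y + z ≤ N := fun k => by
    have h1 : z k ≤ N k - y k := hz k
    have h2 : y k ≤ N k := hy k
    change y k + z k ≤ N k
    omega
  have h := ratio_kernel_eq hq (x := fun k => x k * q ^ y k)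
    (fun k => mul_ne_zero (hx k) (pow_ne_zero _ hq)) hz (injective_qNode_shift hinj y).injOn
  rw [← h, vecSum_sub_vecSum_add hy]
  simp_rw [ratioPoch_eq hq x N (y + z) hyz, ratioPoch_eq hq x (y + z) y (fun _ => Nat.le_add_right _ _),
    prod_inv_distrib, Pi.add_apply, Pi.sub_apply, pow_add, add_tsub_cancel_left, Nat.sub_add_eq,
    mul_assoc]

end Entries

/-! ### The family A. -/

section FamilyA

open Finset Polynomial

variable {K : Type*} [Field K] {n : ℕ}

theorem baileyMStar_mul_baileyM_self_A {q : K} (hq : q ≠ 0) (a : K) (x : Fin (n + 1) → K)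
    (hlast : ∀ i j : Fin (n + 1) → ℕ, j ≤ i → ∀ k, lastPoch q a x k (i k + vecSum j) ≠ 0)
    (hone : ∀ k, 1 - a * (x k / x (Fin.last n)) ≠ 0) (N : Fin (n + 1) → ℕ) :
    baileyMStar .A q a x N N * baileyM .A q a x N N = 1 := by
  have hstep : ∀ k, (1 - a * (x k / x (Fin.last n)) * q ^ (N k + vecSum N)) *
      lastPoch q a x k (N k + vecSum N - 1) = lastPoch q a x k (N k + vecSum N) := by
    intro k
    have hcast : (N k : ℤ) + vecSum N = ((N k + ∑ j, N j : ℕ) : ℤ) := by simp [vecSum]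
    rw [hcast]
    rcases Nat.eq_zero_or_pos (N k + ∑ j, N j) with h0 | hpos
    -- Only here is the index -1 reached; the factor 1 - a x_k / x_ℓ cancels its inverse.
    · have h1 := hone k
      rw [h0]
      have h2 : lastPoch q a x k (((0 : ℕ) : ℤ) - 1) = (1 - a * (x k / x (Fin.last n)))⁻¹ := by
        change (∏ t ∈ range (0 + 1), _)⁻¹ = _
        rw [prod_range_one]
        congr 2
        field_simp
        ring
      rw [h2]
      simp [lastPoch, qPoch_zero, h1]
    · obtain ⟨e, he⟩ : ∃ e, N k + ∑ j, N j = e + 1 := ⟨_, (Nat.sub_add_cancel hpos).symm⟩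
      rw [he, Nat.cast_add, Nat.cast_one, add_sub_cancel_right]
      simp only [lastPoch]
      have h2 : ((e : ℤ) + 1) = ((e + 1 : ℕ) : ℤ) := by push_cast; rfl
      rw [h2, qPoch_natCast_add, prod_range_one, zpow_natCast]
      ring
  simp only [baileyMStar, baileyM, ratioPoch_self, sub_self, signPow_zero, inv_one, prod_const_one,
    mul_one, one_mul]
  rw [← prod_mul_distrib, ← prod_mul_distrib]
  exact prod_eq_one fun k _ => by rw [hstep, mul_inv_cancel₀ (hlast N N le_rfl k)]

/-- The quotient of the two `lastPoch` factors is a finite product of |N| - |y| - 1 terms linear in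
u_k, so the summand is a Vandermonde alternant (`s = ∅`) with exactly the permitted degree. -/
theorem sum_baileyMStar_mul_baileyM_A [CharZero K] {q : K} (hq : q ≠ 0) (a : K)
    {x : Fin (n + 1) → K} (hx : ∀ k, x k ≠ 0) (hinj : Function.Injective (qNode q x))
    (hlast : ∀ i j : Fin (n + 1) → ℕ, j ≤ i → ∀ k, lastPoch q a x k (i k + vecSum j) ≠ 0)
    {y N : Fin (n + 1) → ℕ} (hy : y ≤ N) (hne : y ≠ N) :
    ∑ z ∈ Icc y N, baileyMStar .A q a x N z * baileyM .A q a x z y = 0 := by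
  obtain ⟨k₀, hk₀⟩ : ∃ k, (N - y) k ≠ 0 := by
    by_contra! h
    exact hne (le_antisymm hy fun k => tsub_eq_zero_iff_le.1 (h k))
  have hpos : 1 ≤ ∑ k, (N - y) k :=
    (Nat.one_le_iff_ne_zero.2 hk₀).trans (single_le_sum (fun _ _ => Nat.zero_le _) (mem_univ k₀))
  set p : K[X] := ∏ t ∈ range (∑ k, (N - y) k - 1),
    (1 - C (a * q / x (Fin.last n) * q ^ (∑ k, y k) * q ^ t) * X) with hp
  have hpdeg : p.natDegree ≤ ∑ k, (N - y) k - 1 := by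
    refine (natDegree_prod_le _ _).trans ((sum_le_card_nsmul _ _ 1 fun t _ => ?_).trans (by simp))
    exact (natDegree_sub_le _ _).trans (max_le (by simp) (natDegree_C_mul_le _ _ |>.trans natDegree_X_le))
  have hpeval : ∀ z : Fin (n + 1) → ℕ, ∀ k,
      lastPoch q a x k ((y + z) k + vecSum N - 1) * (lastPoch q a x k ((y + z) k + vecSum y))⁻¹ =
        p.eval (x k * q ^ y k * q ^ z k) := by
    intro z k
    have h0 := hlast (y + z) y (fun _ => Nat.le_add_right _ _) k
    have hsumN : ∑ k, N k = ∑ k, y k + ∑ k, (N - y) k := by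
      rw [← sum_add_distrib]
      exact sum_congr rfl fun k _ => (Nat.add_sub_cancel' (hy k)).symm
    have hcast1 : ((y + z) k : ℤ) + vecSum y = (((y + z) k + ∑ j, y j : ℕ) : ℤ) := by
      simp [vecSum]
    have hcast2 : ((y + z) k : ℤ) + vecSum N - 1 =
        (((y + z) k + ∑ j, y j + (∑ k, (N - y) k - 1) : ℕ) : ℤ) := by
      have h1 : vecSum N = ((∑ k, N k : ℕ) : ℤ) := by simp [vecSum]
      rw [h1, hsumN]
      omega
    rw [hcast1] at h0 ⊢
    rw [hcast2]
    simp only [lastPoch] at h0 ⊢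
    rw [qPoch_natCast_add, mul_comm, ← mul_assoc, inv_mul_cancel₀ h0, one_mul, hp, eval_prod]
    refine prod_congr rfl fun t _ => ?_
    simp only [eval_sub, eval_one, eval_mul, eval_C, eval_X, Pi.add_apply]
    have := hx (Fin.last n)
    field_simp
    ring
  have hvanish := sum_box_nodalWeight_mul_alternant_eq_zero q (fun k => x k * q ^ y k) (N - y)
    (injective_qNode_shift hinj y).injOn ∅ p k₀ (by simp)
    (by simp only [notMem_empty, false_and, if_false, sum_const_zero]; omega)
  rw [sum_Icc_eq_sum_Icc_zero_sub hy]
  rw [← mul_zero (((∏ k, (1 - a * (x k / x (Fin.last n)) * q ^ (N k + vecSum N))) *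
    ((∏ i : Fin (n + 1), ∏ _j ∈ Ioi i, (-1)) * (∏ s, x s * q ^ y s) ^ (∑ k, (N - y) k) *
          signPow q (vecSum (N - y)) * ∏ i, ∏ j ∈ Ioi i, (x i * q ^ y i - x j * q ^ y j)))),
    ← hvanish, mul_sum]
  refine sum_congr rfl fun z hz => ?_
  have hcommon := ratioPoch_mul_ratioPoch_mul_signPow hq hx hinj hy (mem_Icc.1 hz).2
  have halt : alternant ∅ p (fun k => x k * q ^ y k * q ^ z k) =
      (∏ i, ∏ j ∈ Ioi i, (x i * q ^ y i * q ^ z i - x j * q ^ y j * q ^ z j)) *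
        ((∏ k, lastPoch q a x k ((y + z) k + vecSum N - 1)) *
          ∏ k, (lastPoch q a x k ((y + z) k + vecSum y))⁻¹) := by
    rw [← prod_mul_distrib, prod_congr rfl fun k _ => hpeval z k]
    simp [alternant, alternantFactor]
  rw [halt]
  simp only [baileyMStar, baileyM]
  linear_combination (∏ k, (1 - a * (x k / x (Fin.last n)) * q ^ (N k + vecSum N))) *
    ((∏ k, lastPoch q a x k ((y + z) k + vecSum N - 1)) *
          ∏ k, (lastPoch q a x k ((y + z) k + vecSum y))⁻¹) * hcommon

end FamilyA

/-! ### The family C. -/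

section FamilyC

open Finset Polynomial

variable {K : Type*} [Field K] {m n : ℕ}

theorem baileyMStar_mul_baileyM_self_C (q a : K) (x : Fin (n + 1) → K)
    (hdist : ∀ (i : Fin (n + 1) → ℕ) (r s), r < s → 1 - x r * x s * q ^ (i r + i s) ≠ 0)
    (N : Fin (n + 1) → ℕ) :
    baileyMStar .C q a x N N * baileyM .C q a x N N = 1 := by
  simp only [baileyMStar, baileyM, ratioPoch_self, prodPoch_self, prodPochStar_self, sub_self,
    signPow_zero, inv_one, prod_const_one, mul_one, one_mul]
  exact prod_eq_one fun r _ => prod_eq_one fun s hs => div_self (hdist N r s (mem_Ioi.1 hs))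

/-- The three products cover the exponents 1..z, z+b..z+b+d-1 and z+1..z+b-1, which join up to
1..z+d+b-1. If b = 0 and z + d ≠ 0, the exponent z occurs once too often. If all three vanish,
truncated subtraction leaves the empty product. -/
theorem qPoch_mul_qPoch_mul_prod (q c : K) (z d b : ℕ) :
    qPoch q (q * c) z * qPoch q (c * q ^ (z + b)) d *
        ∏ t ∈ range (b - 1), (1 - c * q ^ z * q ^ (t + 1)) =
      qPoch q (q * c) ((z + d + b - 1 : ℕ) : ℤ) *
        if z + d ≠ 0 ∧ b = 0 then 1 - c * q ^ z else 1 := by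
  rcases b with _ | b
  · rcases d with _ | d
    · rcases z with _ | z
      · simp [qPoch_zero]
      · simp only [add_zero, Nat.add_sub_cancel, qPoch_natCast, prod_range_succ, Nat.zero_sub,
          prod_range_zero]
        simp [pow_succ]
        left; ring
    · have h : z + (d + 1) + 0 - 1 = z + d := by omega
      rw [h, qPoch_natCast_add q (q * c), if_pos ⟨by omega, rfl⟩, qPoch_natCast _ _ (d + 1),
        prod_range_succ']
      simp only [Nat.zero_sub, prod_range_zero, mul_one, pow_zero, add_zero, mul_assoc]
      congr 2
      exact prod_congr rfl fun t _ => by ring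
  · have h : z + d + (b + 1) - 1 = z + b + d := by omega
    rw [h, qPoch_natCast_add, qPoch_natCast_add, qPoch_natCast _ _ d, if_neg (by omega), mul_one,
      Nat.add_sub_cancel, mul_right_comm, mul_assoc, mul_assoc]
    congr 1
    congr 1
    · exact prod_congr rfl fun t _ => by ring
    · exact prod_congr rfl fun t _ => by ring

/-- The polynomial `∏_s (q x_s X; q)_{N_s - 1}`. -/
noncomputable def nodeProductPoly (q : K) (x : Fin m → K) (N : Fin m → ℕ) : K[X] :=
  ∏ s, ∏ t ∈ range (N s - 1), (1 - C (x s * q ^ (t + 1)) * X)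

theorem eval_nodeProductPoly (q : K) (x : Fin m → K) (N : Fin m → ℕ) (u : K) :
    (nodeProductPoly q x N).eval u =
      ∏ s, ∏ t ∈ range (N s - 1), (1 - u * x s * q ^ (t + 1)) := by
  simp only [nodeProductPoly, eval_prod, eval_sub, eval_one, eval_mul, eval_C, eval_X]
  exact prod_congr rfl fun s _ => prod_congr rfl fun t _ => by ring

theorem natDegree_nodeProductPoly_le (q : K) (x : Fin m → K) (N : Fin m → ℕ) :
    (nodeProductPoly q x N).natDegree ≤ ∑ s, (N s - 1) := by
  refine (natDegree_prod_le _ _).trans (sum_le_sum fun s _ => (natDegree_prod_le _ _).trans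
    ((sum_le_card_nsmul _ _ 1 fun t _ => ?_).trans (by simp)))
  exact (natDegree_sub_le _ _).trans
    (max_le (by simp) ((natDegree_C_mul_le _ _).trans natDegree_X_le))

/-- The part of `M*(N; z) M(z; 0)` specific to the family `C`. -/
theorem product_kernel_eq {q : K} {x : Fin m → K} {N z : Fin m → ℕ} (hz : z ≤ N)
    (hpos : ∀ r s (e : ℕ), 1 - x r * x s * q ^ (e + 1) ≠ 0)
    (hdist : ∀ r s, r < s → 1 - x r * x s ≠ 0) :
    (∏ r, ∏ s, (qPoch q (x r * x s * q ^ (z r + N s)) (N r - z r : ℕ))⁻¹) *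
        (∏ r, ∏ s, (qPoch q (q * (x r * x s)) (z r))⁻¹) *
        (∏ r, ∏ s ∈ Ioi r, (1 - x r * q ^ z r * (x s * q ^ z s))) =
      ((∏ r, ∏ s, (qPoch q (q * (x r * x s)) (N r + N s - 1 : ℕ))⁻¹) *
          ∏ r, ∏ s ∈ Ioi r, if N r = 0 ∧ N s = 0 then 1 - x r * x s else 1) *
        ((∏ r, ∏ s ∈ Ioi r, (1 - if r ∈ univ.filter (N · ≠ 0) ∧ s ∈ univ.filter (N · ≠ 0) then
            x r * q ^ z r * (x s * q ^ z s) else 0)) *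
          ∏ k, (nodeProductPoly q x N).eval (x k * q ^ z k)) := by
  have hq : ∀ r s (e : ℕ), qPoch q (q * (x r * x s)) (e : ℤ) ≠ 0 := fun r s e => by
    rw [qPoch_natCast]
    refine prod_ne_zero_iff.2 fun t _ => ?_
    convert hpos r s t using 2
    ring
  have hstar : ∀ r s, qPoch q (x r * x s * q ^ (z r + N s)) (N r - z r : ℕ) ≠ 0 := fun r s => by
    rw [qPoch_natCast]
    refine prod_ne_zero_iff.2 fun t ht => ?_
    have h1 : t < N r - z r := mem_range.1 ht
    rw [mul_assoc, ← pow_add]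
    rcases Nat.eq_zero_or_pos (z r + N s + t) with h0 | h0
    · rw [h0, pow_zero, mul_one]
      -- Exponent 0 forces N_s = 0 while t < N_r - z_r, so the factor is off the diagonal and
      -- `hdist` applies.
      have hrs : r ≠ s := by rintro rfl; omega
      rcases lt_or_gt_of_ne hrs with h2 | h2
      · exact hdist r s h2
      · rw [mul_comm]; exact hdist s r h2
    · rw [← Nat.sub_add_cancel h0]
      exact hpos r s _
  -- For N_s = 0 the factor (q x_s u_r)_{N_s - 1} ought to be 1 / (1 - x_s u_r), but truncated
  -- subtraction replaces it by 1; `L` records the discrepancy.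
  set L : Fin m → Fin m → K := fun r s =>
    if N r ≠ 0 ∧ N s = 0 then 1 - x r * q ^ z r * (x s * q ^ z s) else 1 with hL
  have hpair : ∀ r s, (∏ t ∈ range (N s - 1), (1 - x r * q ^ z r * x s * q ^ (t + 1))) =
      (qPoch q (x r * x s * q ^ (z r + N s)) (N r - z r : ℕ))⁻¹ *
        (qPoch q (q * (x r * x s)) (z r))⁻¹ * qPoch q (q * (x r * x s)) (N r + N s - 1 : ℕ) *
        L r s := by
    intro r s
    have h := qPoch_mul_qPoch_mul_prod q (x r * x s) (z r) (N r - z r) (N s)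
    rw [Nat.add_sub_cancel' (hz r)] at h
    have hLrs : L r s = if N r ≠ 0 ∧ N s = 0 then 1 - x r * x s * q ^ z r else 1 := by
      simp only [hL]
      split_ifs with hrs
      · have h0 : z s = 0 := Nat.le_zero.1 (hrs.2 ▸ hz s)
        rw [h0]; ring
      · rfl
    rw [hLrs, mul_assoc _ (qPoch _ _ (N r + N s - 1 : ℕ)), ← h]
    have h1 := hq r s (z r)
    have h2 := hstar r s
    simp_rw [mul_right_comm (x r) (q ^ z r) (x s)]
    have halg : ∀ a b c : K, a ≠ 0 → b ≠ 0 → c = b⁻¹ * a⁻¹ * (a * b * c) := by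
      intro a b c ha hb
      field_simp
    exact halg _ _ _ h1 h2
  have hdiag : ∏ r, ∏ s, L r s = ∏ r, ∏ s ∈ Ioi r, (L r s * L s r) := by
    rw [prod_prod_eq_prod_diag_mul_prod_Ioi, prod_eq_one, one_mul]
    intro r _
    simp only [hL]
    rw [if_neg (fun h => h.1 h.2)]
  simp_rw [eval_nodeProductPoly, hpair, prod_mul_distrib]
  rw [hdiag]
  -- The factor is constant if both N_r and N_s vanish, remains in the alternant if neither does,
  -- and is absorbed by `L` if exactly one does.
  have hfactor : ∀ r s, 1 - x r * q ^ z r * (x s * q ^ z s) =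
      (if N r = 0 ∧ N s = 0 then 1 - x r * x s else 1) *
        (1 - if r ∈ univ.filter (N · ≠ 0) ∧ s ∈ univ.filter (N · ≠ 0) then
          x r * q ^ z r * (x s * q ^ z s) else 0) * (L r s * L s r) := by
    intro r s
    simp only [hL, mem_filter, mem_univ, true_and]
    have hzr : N r = 0 → z r = 0 := fun h0 => Nat.le_zero.1 (h0 ▸ hz r)
    have hzs : N s = 0 → z s = 0 := fun h0 => Nat.le_zero.1 (h0 ▸ hz s)
    by_cases hr : N r = 0 <;> by_cases hs : N s = 0 <;> simp [hr, hs, hzr, hzs, mul_comm]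
  simp_rw [prod_congr rfl fun r _ => prod_congr rfl fun s _ => hfactor r s]
  have hK : ∏ r, ∏ s, qPoch q (q * (x r * x s)) ((N r + N s - 1 : ℕ) : ℤ) ≠ 0 :=
    prod_ne_zero_iff.2 fun r _ => prod_ne_zero_iff.2 fun s _ => hq r s _
  have halg : ∀ T₁ T₂ c e L₁ L₂ k : K, k ≠ 0 →
      T₁ * T₂ * (c * e * (L₁ * L₂)) = k⁻¹ * c * (e * (T₁ * T₂ * k * (L₁ * L₂))) := by
    intro T₁ T₂ c e L₁ L₂ k hk
    field_simp
  simp_rw [prod_mul_distrib, prod_inv_distrib]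
  exact halg _ _ _ _ _ _ _ hK

/-- Let `s` be the set of k with d_k = N_k - y_k ≠ 0. The factors 1 - u_{k₀} u_j with `j ∈ s` add #s
- 1 to the degree in u_{k₀}, and p adds at most |d| - #s. The total |d| - 1 is just what the
vanishing lemma permits. -/
theorem sum_baileyMStar_mul_baileyM_C [CharZero K] {q : K} (hq : q ≠ 0) (a : K)
    {x : Fin (n + 1) → K} (hx : ∀ k, x k ≠ 0) (hinj : Function.Injective (qNode q x))
    (hprod : ∀ i j : Fin (n + 1) → ℕ, j ≤ i → ∀ r s, prodPoch q x i j r s ≠ 0)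
    (hdist : ∀ (i : Fin (n + 1) → ℕ) (r s), r < s → 1 - x r * x s * q ^ (i r + i s) ≠ 0)
    {y N : Fin (n + 1) → ℕ} (hy : y ≤ N) (hne : y ≠ N) :
    ∑ z ∈ Icc y N, baileyMStar .C q a x N z * baileyM .C q a x z y = 0 := by
  obtain ⟨k₀, hk₀⟩ : ∃ k, (N - y) k ≠ 0 := by
    by_contra! h
    exact hne (le_antisymm hy fun k => tsub_eq_zero_iff_le.1 (h k))
  set x' : Fin (n + 1) → K := fun k => x k * q ^ y k with hx'
  set s : Finset (Fin (n + 1)) := univ.filter ((N - y) · ≠ 0) with hs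
  have hpos : ∀ r s (e : ℕ), 1 - x' r * x' s * q ^ (e + 1) ≠ 0 := by
    intro r s e h0
    -- The required quantity is the last of the e + 1 factors of this denominator.
    have h1 := hprod (y + fun _ => e + 1) y (fun _ => Nat.le_add_right _ _) r s
    rw [prodPoch] at h1
    have h2 : (((y + fun _ => e + 1 : Fin (n + 1) → ℕ) r : ℕ) : ℤ) - y r = ((e + 1 : ℕ) : ℤ) := by simp
    rw [h2, qPoch_natCast, prod_range_succ] at h1
    refine right_ne_zero_of_mul h1 (Eq.trans ?_ h0)
    simp only [hx']
    ring
  have hdist' : ∀ r s, r < s → 1 - x' r * x' s ≠ 0 := by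
    intro r s hrs
    convert hdist y r s hrs using 2
    simp only [hx']
    ring
  have hvanish := sum_box_nodalWeight_mul_alternant_eq_zero q x' (N - y)
    (injective_qNode_shift hinj y).injOn s (nodeProductPoly q x' (N - y)) k₀ (by
      intro k
      by_cases hk : (N - y) k = 0
      · exact Or.inr hk
      · left
        simp only [hs, mem_filter, mem_univ, true_and]
        exact ⟨fun _ => hk₀, fun _ => hk⟩) (by
      have h1 := natDegree_nodeProductPoly_le q x' (N - y)
      have h2 : ∑ k, (N - y) k = ∑ k, ((N - y) k - 1) + ∑ k, if k ∈ s then 1 else 0 := by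
        rw [← sum_add_distrib]
        refine sum_congr rfl fun k _ => ?_
        simp only [hs, mem_filter, mem_univ, true_and]
        split_ifs <;> omega
      have h3 : k₀ ∈ s := by simp only [hs, mem_filter, mem_univ, true_and]; exact hk₀
      rw [← add_sum_erase univ (fun k => if k ∈ s then 1 else 0) (mem_univ k₀), if_pos h3] at h2
      simp only [h3, true_and]
      omega)
  rw [sum_Icc_eq_sum_Icc_zero_sub hy]
  rw [← mul_zero ((∏ r, ∏ s ∈ Ioi r, (1 - x r * x s * q ^ (N r + N s))⁻¹) *
    ((∏ i : Fin (n + 1), ∏ _j ∈ Ioi i, (-1)) * (∏ s, x' s) ^ (∑ k, (N - y) k) *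
          signPow q (vecSum (N - y)) * ∏ i, ∏ j ∈ Ioi i, (x' i - x' j)) *
    ((∏ r, ∏ s, (qPoch q (q * (x' r * x' s)) ((N - y) r + (N - y) s - 1 : ℕ))⁻¹) *
          ∏ r, ∏ s ∈ Ioi r, if (N - y) r = 0 ∧ (N - y) s = 0 then 1 - x' r * x' s else 1)),
    ← hvanish, mul_sum]
  refine sum_congr rfl fun z hz => ?_
  have hz' : z ≤ N - y := (mem_Icc.1 hz).2
  have hcommon := ratioPoch_mul_ratioPoch_mul_signPow hq hx hinj hy hz'
  have hspecific := product_kernel_eq hz' hpos hdist'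
  have halt : alternant s (nodeProductPoly q x' (N - y)) (fun k => x' k * q ^ z k) =
      (∏ i, ∏ j ∈ Ioi i, (x' i * q ^ z i - x' j * q ^ z j)) *
        ((∏ i, ∏ j ∈ Ioi i, (1 - if i ∈ s ∧ j ∈ s then
            x' i * q ^ z i * (x' j * q ^ z j) else 0)) *
          ∏ k, (nodeProductPoly q x' (N - y)).eval (x' k * q ^ z k)) := by
    simp only [alternant, alternantFactor, prod_mul_distrib, mul_assoc]
  have hstar : ∀ r s, prodPochStar q x N (y + z) r s =
      qPoch q (x' r * x' s * q ^ (z r + (N - y) s)) ((N - y) r - z r : ℕ) := by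
    intro r s
    have h1 : y s ≤ N s := hy s
    have h2 : y r ≤ N r := hy r
    have h3 : z r ≤ N r - y r := hz' r
    have h4 : (N r : ℤ) - ((y + z) r : ℕ) = ((N - y) r - z r : ℕ) := by
      simp only [Pi.add_apply, Pi.sub_apply]; omega
    rw [prodPochStar, h4]
    congr 1
    have h5 : (y + z) r + N s = y r + y s + (z r + (N - y) s) := by
      simp only [Pi.add_apply, Pi.sub_apply]; omega
    rw [h5, pow_add, pow_add]
    simp only [hx']
    ring
  have hplain : ∀ r s, prodPoch q x (y + z) y r s = qPoch q (q * (x' r * x' s)) (z r) := by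
    intro r s
    have h4 : (((y + z) r : ℕ) : ℤ) - y r = (z r : ℕ) := by simp
    rw [prodPoch, h4]
    congr 1
    simp only [hx', pow_add]
    ring
  have hnum : ∀ r s, 1 - x r * x s * q ^ ((y + z) r + (y + z) s) =
      1 - x' r * q ^ z r * (x' s * q ^ z s) := by
    intro r s
    simp only [hx', Pi.add_apply, pow_add]
    ring
  rw [halt]
  simp only [baileyMStar, baileyM, div_eq_mul_inv, hstar, hplain, hnum, prod_mul_distrib]
  linear_combination (∏ r, ∏ s ∈ Ioi r, (1 - x r * x s * q ^ (N r + N s))⁻¹) *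
    ((∏ r, ∏ s, (qPoch q (x' r * x' s * q ^ (z r + (N - y) s)) ((N - y) r - z r : ℕ))⁻¹) *
        (∏ r, ∏ s, (qPoch q (q * (x' r * x' s)) (z r))⁻¹) *
        (∏ r, ∏ s ∈ Ioi r, (1 - x' r * q ^ z r * (x' s * q ^ z s)))) * hcommon +
    (∏ r, ∏ s ∈ Ioi r, (1 - x r * x s * q ^ (N r + N s))⁻¹) *
    ((∏ i : Fin (n + 1), ∏ _j ∈ Ioi i, (-1)) * (∏ s, x' s) ^ (∑ k, (N - y) k) *
          signPow q (vecSum (N - y)) * ∏ i, ∏ j ∈ Ioi i, (x' i - x' j)) *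
    ((∏ k, Lagrange.nodalWeight (nodeLabels (N - y)) (qNode q x') ⟨k, z k⟩) *
          ∏ i, ∏ j ∈ Ioi i, (x' i * q ^ z i - x' j * q ^ z j)) * hspecific

end FamilyC

theorem mainTheorem2 {K : Type*} [Field K] [Algebra ℂ K] (n : ℕ) (G : RootFamily)
    (q : ℂ) (hq0 : q ≠ 0) (hq1 : ‖q‖ < 1) (a : K) (x : Fin (n + 1) → K)
    (hden : DenominatorsNeZero G (algebraMap ℂ K q) a x)
    (A B : (Fin (n + 1) → ℕ) → K) :
    IsBaileyPair G (algebraMap ℂ K q) a x A B ↔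
      ∀ N : Fin (n + 1) → ℕ,
        A N = ∑ y ∈ Finset.Icc 0 N, baileyMStar G (algebraMap ℂ K q) a x N y * B y := by
  have : CharZero K := charZero_of_injective_algebraMap (algebraMap ℂ K).injective
  have hq : algebraMap ℂ K q ≠ 0 := (map_ne_zero _).2 hq0
  obtain ⟨hx, hratio, hG⟩ := hden
  have hinj := qNode_injOn hq hx hratio
  refine forall_eq_sum_iff_of_sum_mul_eq_ite _ _ (fun N y hy => ?_) A B
  split_ifs with hyN
  · subst hyN
    rw [Finset.Icc_self, Finset.sum_singleton]
    cases G with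
    | A => exact baileyMStar_mul_baileyM_self_A hq a x hG.1 hG.2 y
    | C => exact baileyMStar_mul_baileyM_self_C _ a x hG.2.2 y
  · cases G with
    | A => exact sum_baileyMStar_mul_baileyM_A hq a hx hinj hG.1 hy hyN
    | C => exact sum_baileyMStar_mul_baileyM_C hq a hx hinj hG.1 hG.2.2 hy hyN
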